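/- There is a universal constant $c>0$ such that the following holds. Let $G=(V,E)$ be a finite simple graph, $b\in\mathbb N$ and $n\ge 2$, and consider a Pauli subsystem code on $n$ qubits with parameters $[[n,k,d]]$, given by a gauge group $\mathcal G$ of Pauli operators (considered up to phase). Here $N(\mathcal G)$ is the group of Pauli operators commuting with $\mathcal G$, $k$ is defined by $|N(\mathcal G)/(N(\mathcal G)\cap\mathcal G)|=4^k$ (groups up to phase), and $d$ is the minimum weight of an element of $N(\mathcal G)\cdot\mathcal G\setminus\mathcal G$ (with $d=0$ if this set is empty, i.e. if $k=0$). Suppose the code has connectivity graph $G$ with at most $b$ qubits per vertex: the qubits are placed on vertices of $G$, at most $b$ on each, and $\mathcal G$ is generated by Pauli operators each of which acts nontrivially only on qubits that pairwise lie on the same vertex or on adjacent vertices. (If the qubits are the vertices of $G$, then $b=1$.) A finite graph $H$ with vertex set $W$ is called an $\alpha$-expander if $|E(S,W\setminus S)|\ge\alpha\min(|S|,|W\setminus S|)$ for every nonempty proper subset $S\subset W$, where $E(S,W\setminus S)$ is the set of edges between $S$ and $W\setminus S$. Then: 1. There are pairwise disjoint vertex sets whose induced subgraphs $H_1,\dots,H_r$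 of $G$ satisfy $|H_j|\ge \frac{d}{3b}$ for every $j$, $\sum_j|H_j|\ge\frac{k}{2b}$, and every $H_j$ is a $\frac{k}{4cb\,n\log n}$-expander. In particular, for one qubit per vertex, $|H_j|\ge d/3$, $\sum_j|H_j|\ge k/2$, and every $H_j$ is a $\frac{k}{4c\,n\log n}$-expander. 2. Consequently, a connectivity graph whose linear-size subgraphs have expansion at most $\alpha$ allows at best $[[n,\tilde O(\alpha n),\Theta(n)]]$ codes. That is, always $d\le n$; and if $\delta>0$, $\alpha\ge0$, $d\ge\delta n$, and no induced subgraph of $G$ on at least $\frac{\delta n}{3b}$ vertices is a $\beta$-expander for any $\beta>\alpha$, then $k\le 4cb\,\alpha\, n\log n$. -/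

import Mathlib

/-! ### Pauli operators and subsystem codes (binary symplectic representation) -/

/-- An `n`-qubit Pauli operator up to phase. On qubit `i` the pair `(x, z)` stands for `X ^ x * Z ^ z`:
`(0, 0)` is `I`, `(1, 0)` is `X`, `(0, 1)` is `Z`, `(1, 1)` is `Y`. Multiplication of Pauli operators
up to phase is addition of vectors. -/
abbrev Pauli (n : ℕ) : Type := Fin n → ZMod 2 × ZMod 2

namespace Pauli

/-- The number of qubits on which a Pauli operator acts nontrivially. -/
noncomputable def weight {n : ℕ} (P : Pauli n) : ℕ := {i : Fin n | P i ≠ 0}.ncard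

/-- The commutation form: `commForm n P Q` is `0` if `P` and `Q` commute, `1` if they anticommute. -/
def commForm (n : ℕ) : LinearMap.BilinForm (ZMod 2) (Pauli n) :=
  LinearMap.mk₂ (ZMod 2)
    (fun P Q => ∑ i, ((P i).1 * (Q i).2 + (P i).2 * (Q i).1))
    (fun P P' Q => by
      rw [← Finset.sum_add_distrib]
      exact Finset.sum_congr rfl fun i _ => by simp only [Pi.add_apply, Prod.fst_add, Prod.snd_add]; ring)
    (fun a P Q => by
      rw [smul_eq_mul, Finset.mul_sum]
      exact Finset.sum_congr rfl fun i _ => by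
        simp only [Pi.smul_apply, Prod.smul_fst, Prod.smul_snd, smul_eq_mul]; ring)
    (fun P Q Q' => by
      rw [← Finset.sum_add_distrib]
      exact Finset.sum_congr rfl fun i _ => by simp only [Pi.add_apply, Prod.fst_add, Prod.snd_add]; ring)
    (fun a P Q => by
      rw [smul_eq_mul, Finset.mul_sum]
      exact Finset.sum_congr rfl fun i _ => by
        simp only [Pi.smul_apply, Prod.smul_fst, Prod.smul_snd, smul_eq_mul]; ring)

end Pauli

/-- A (Pauli) subsystem code on `n` qubits, given by its gauge group, an arbitrary group of
`n`-qubit Pauli operators up to phase. -/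
structure SubsystemCode (n : ℕ) where
  gauge : Submodule (ZMod 2) (Pauli n)

namespace SubsystemCode

variable {n : ℕ}

/-- `N(𝒢)`: the Pauli operators that commute with every element of the gauge group. -/
def normalizer (C : SubsystemCode n) : Submodule (ZMod 2) (Pauli n) :=
  (Pauli.commForm n).orthogonal C.gauge

/-- `(N(𝒢) · 𝒢) \ 𝒢`: the (nontrivial, dressed) logical operators. -/
def logicals (C : SubsystemCode n) : Set (Pauli n) :=
  {P | P ∈ C.normalizer ⊔ C.gauge ∧ P ∉ C.gauge}

/-- The code distance: the least weight of a logical operator (`0` if there is none, which happens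
only for codes that encode no qubit). -/
noncomputable def distance (C : SubsystemCode n) : ℕ := sInf (Pauli.weight '' C.logicals)

/-- The code, on `n` qubits, is an `[[n, k, d]]` code. The bare logical operators modulo the
stabilizer group `N(𝒢) ∩ 𝒢` form the group of `k`-qubit Pauli operators up to phase, which has
dimension `2 * k` over the field with two elements. -/
def HasParameters (C : SubsystemCode n) (k d : ℕ) : Prop :=
  Module.finrank (ZMod 2) C.normalizer =
      2 * k + Module.finrank (ZMod 2) (C.normalizer ⊓ C.gauge : Submodule (ZMod 2) (Pauli n)) ∧
    C.distance = d

/-- The code has connectivity graph `G`, with at most `b` qubits per vertex: the qubits can be placed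
on vertices of `G`, at most `b` on each, in such a way that the gauge group is generated by checks
each of which only involves qubits that pairwise sit on the same vertex or on adjacent vertices. -/
def HasConnectivity {V : Type*} (C : SubsystemCode n) (G : SimpleGraph V) (b : ℕ) : Prop :=
  ∃ (place : Fin n → V) (checks : Set (Pauli n)),
    (∀ v, {i | place i = v}.ncard ≤ b) ∧
    Submodule.span (ZMod 2) checks = C.gauge ∧
    ∀ P ∈ checks, ∀ i j, P i ≠ 0 → P j ≠ 0 → place i = place j ∨ G.Adj (place i) (place j)

end SubsystemCode

/-! ### Graph expansion -/

/-- `E(S, V \ S)`: the edges of `G` with one endpoint in `S` and the other one outside `S`. -/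
def SimpleGraph.cutEdges {V : Type*} (G : SimpleGraph V) (S : Set V) : Set (Sym2 V) :=
  {e | ∃ u ∈ S, ∃ v ∈ Sᶜ, G.Adj u v ∧ e = s(u, v)}

/-- A finite graph is an `α`-expander if `|E(S, V \ S)| / min (|S|, |V \ S|) ≥ α` for every set `S`
of vertices for which the quotient makes sense, that is, with `S` and `V \ S` nonempty. -/
def SimpleGraph.IsExpander {V : Type*} [Finite V] (G : SimpleGraph V) (α : ℝ) : Prop :=
  ∀ S : Set V, S.Nonempty → Sᶜ.Nonempty →
    α ≤ ((G.cutEdges S).ncard : ℝ) / ((min S.ncard Sᶜ.ncard : ℕ) : ℝ)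

/-! ### Codes from regions without logical operators -/

namespace Pauli

variable {n : ℕ}

/-! Cut the occupied vertices recursively along sparse cuts, stopping at pieces that are expanders
or hold too few qubits to support a logical operator. Delete the expanders and one side of the
boundary of every cut. The surviving pieces support no bare logical operator and no check meets two
of them, so neither does their union (`NoBareLogical.union`). By cleaning
(`le_ncard_of_noBareLogical_compl`), the deleted vertices carry at least `k` qubits. A cut costs at
most `α` times its smaller side, and the potential `x log x` bounds the total cost by `α n log n /
log 2`. For the chosen `α` this accounts for at most `k / 2` qubits; the expanders must carry the
rest. -/

theorem commForm_apply (P Q : Pauli n) :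
    commForm n P Q = ∑ i, ((P i).1 * (Q i).2 + (P i).2 * (Q i).1) := rfl

theorem commForm_comm (P Q : Pauli n) : commForm n P Q = commForm n Q P := by
  simp only [commForm_apply]
  exact Finset.sum_congr rfl fun i _ => by ring

theorem commForm_isRefl : (commForm n).IsRefl := fun P Q h => by rw [commForm_comm, h]

theorem commForm_single_right (P : Pauli n) (i : Fin n) (a : ZMod 2 × ZMod 2) :
    commForm n P (Pi.single i a) = (P i).1 * a.2 + (P i).2 * a.1 := by
  rw [commForm_apply, Finset.sum_eq_single i]
  · simp
  · intro j _ hj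
    simp [Pi.single_eq_of_ne hj]
  · simp

theorem eq_zero_of_commForm_single {P : Pauli n} {i : Fin n}
    (h : ∀ a, commForm n P (Pi.single i a) = 0) : P i = 0 := by
  have h₁ := h (0, 1)
  have h₂ := h (1, 0)
  rw [commForm_single_right] at h₁ h₂
  ext <;> simp_all

theorem commForm_nondegenerate : (commForm n).Nondegenerate := by
  exact commForm_isRefl.nondegenerate_iff_separatingLeft.2 fun P hP =>
    funext fun i => eq_zero_of_commForm_single fun a => hP _

/-- Paulis with disjoint supports commute. -/
theorem commForm_eq_zero_of_disjoint {P Q : Pauli n} (h : ∀ i, P i = 0 ∨ Q i = 0) :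
    commForm n P Q = 0 := by
  rw [commForm_apply]
  refine Finset.sum_eq_zero fun i _ => ?_
  rcases h i with h | h <;> simp [h]

theorem finrank_pauli : Module.finrank (ZMod 2) (Pauli n) = 2 * n := by
  simp [Pauli, Module.finrank_pi_fintype, mul_comm]

/-- The Paulis supported on a set of qubits. -/
noncomputable def supportedOn (s : Set (Fin n)) : Submodule (ZMod 2) (Pauli n) :=
  open Classical in
  LinearMap.range (LinearMap.pi fun i =>
    if h : i ∈ s then LinearMap.proj (⟨i, h⟩ : s) else 0 :
      (s → ZMod 2 × ZMod 2) →ₗ[ZMod 2] Pauli n)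

theorem single_mem_supportedOn {s : Set (Fin n)} {i : Fin n} (hi : i ∈ s) (a : ZMod 2 × ZMod 2) :
    (Pi.single i a : Pauli n) ∈ supportedOn s := by
  classical
  refine ⟨Pi.single ⟨i, hi⟩ a, funext fun j => ?_⟩
  by_cases hj : j = i
  · subst hj
    simp [hi]
  · by_cases hs : j ∈ s
    · simp [hs, hj]
    · simp [hs, hj]

theorem finrank_supportedOn_le (s : Set (Fin n)) :
    Module.finrank (ZMod 2) (supportedOn s) ≤ 2 * s.ncard := by
  classical
  refine (LinearMap.finrank_range_le _).trans ?_
  simp [Module.finrank_pi_fintype, mul_comm, Set.ncard_eq_toFinset_card']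

end Pauli

namespace SubsystemCode

variable {n : ℕ}

theorem finrank_normalizer (C : SubsystemCode n) :
    Module.finrank (ZMod 2) C.normalizer = 2 * n - Module.finrank (ZMod 2) C.gauge := by
  rw [normalizer, LinearMap.BilinForm.finrank_orthogonal Pauli.commForm_nondegenerate,
    Pauli.finrank_pauli]

/-- A set of qubits that supports no nontrivial bare logical operator. -/
def NoBareLogical (C : SubsystemCode n) (s : Set (Fin n)) : Prop :=
  ∀ P ∈ C.normalizer, (∀ i, P i ≠ 0 → i ∈ s) → P ∈ C.gauge

/-- If the complement of `s` supports no bare logical operator, then all logical operators can be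
cleaned onto `s`, so that `s` has at least as many qubits as are encoded. -/
theorem le_ncard_of_noBareLogical_compl {C : SubsystemCode n} {k d : ℕ} (hC : C.HasParameters k d)
    {s : Set (Fin n)} (hs : C.NoBareLogical sᶜ) : k ≤ s.ncard := by
  have hle : (Pauli.commForm n).orthogonal (C.gauge ⊔ Pauli.supportedOn s) ≤
      C.normalizer ⊓ C.gauge := by
    intro P hP
    rw [LinearMap.BilinForm.mem_orthogonal_iff] at hP
    have hN : P ∈ C.normalizer := fun Q hQ => hP Q (Submodule.mem_sup_left hQ)
    refine ⟨hN, hs P hN fun i hi his => hi (Pauli.eq_zero_of_commForm_single fun a => ?_)⟩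
    rw [Pauli.commForm_comm]
    exact hP _ (Submodule.mem_sup_right (Pauli.single_mem_supportedOn his a))
  -- With `g = dim 𝒢`, this reads `2n - dim (𝒢 + supportedOn s) ≤ (2n - g) - 2k`, while `dim (𝒢 +
  -- supportedOn s) ≤ g + 2|s|`. The bound `g ≤ 2n` in `h₅` keeps the natural subtraction honest.
  have h₁ := Submodule.finrank_mono hle
  rw [LinearMap.BilinForm.finrank_orthogonal Pauli.commForm_nondegenerate,
    Pauli.finrank_pauli] at h₁
  have h₂ := hC.1
  rw [C.finrank_normalizer] at h₂
  have h₃ := Submodule.finrank_add_le_finrank_add_finrank C.gauge (Pauli.supportedOn s)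
  have h₄ := Pauli.finrank_supportedOn_le s
  have h₅ := Submodule.finrank_le C.gauge
  rw [Pauli.finrank_pauli] at h₅
  lia

theorem distance_le_weight {C : SubsystemCode n} {P : Pauli n} (hP : P ∈ C.logicals) :
    C.distance ≤ P.weight :=
  Nat.sInf_le ⟨P, hP, rfl⟩

theorem distance_le (C : SubsystemCode n) : C.distance ≤ n := by
  rcases C.logicals.eq_empty_or_nonempty with h | ⟨P, hP⟩
  · simp [distance, h]
  · refine (distance_le_weight hP).trans ?_
    simpa [Pauli.weight] using Set.ncard_le_card {i : Fin n | P i ≠ 0}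

theorem noBareLogical_of_ncard_lt {C : SubsystemCode n} {s : Set (Fin n)}
    (hs : s.ncard < C.distance) : C.NoBareLogical s := by
  intro P hP hPs
  by_contra hG
  have h₁ := distance_le_weight (C := C) ⟨Submodule.mem_sup_left hP, hG⟩
  have h₂ : P.weight ≤ s.ncard := Set.ncard_le_ncard hPs
  lia

theorem mem_normalizer_of_span {C : SubsystemCode n} {checks : Set (Pauli n)}
    (hspan : Submodule.span (ZMod 2) checks = C.gauge) {P : Pauli n}
    (h : ∀ Q ∈ checks, Pauli.commForm n Q P = 0) : P ∈ C.normalizer := by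
  intro Q hQ
  rw [← hspan] at hQ
  change Pauli.commForm n Q P = 0
  induction hQ using Submodule.span_induction with
  | mem Q hQ => exact h Q hQ
  | zero => simp
  | add Q R _ _ hQ hR => simp [hQ, hR]
  | smul a Q _ hQ => simp [hQ]

/-- The union lemma: if no check acts on two disjoint regions at once, and neither of them supports
a bare logical operator, then neither does their union. -/
theorem NoBareLogical.union {C : SubsystemCode n} {checks : Set (Pauli n)}
    (hspan : Submodule.span (ZMod 2) checks = C.gauge) {s t : Set (Fin n)} (hst : Disjoint s t)
    (hdec : ∀ Q ∈ checks, (∀ i ∈ s, Q i = 0) ∨ ∀ i ∈ t, Q i = 0)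
    (hs : C.NoBareLogical s) (ht : C.NoBareLogical t) : C.NoBareLogical (s ∪ t) := by
  classical
  intro P hP hPst
  have hsum : P = s.indicator P + t.indicator P := by
    refine Eq.trans ?_ (Set.indicator_union_of_disjoint hst P)
    exact (Set.indicator_eq_self.2 fun i hi => hPst i hi).symm
  -- A check commutes with `P` and trivially with the restriction to the region it misses, hence
  -- also with the other restriction.
  have hcomm : ∀ Q ∈ checks, Pauli.commForm n Q (s.indicator P) +
      Pauli.commForm n Q (t.indicator P) = 0 := by
    intro Q hQ
    rw [← map_add, ← hsum]
    exact hP Q (hspan ▸ Submodule.subset_span hQ)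
  have hzero : ∀ Q : Pauli n, ∀ u : Set (Fin n), (∀ i ∈ u, Q i = 0) →
      Pauli.commForm n Q (u.indicator P) = 0 := fun Q u hu =>
    Pauli.commForm_eq_zero_of_disjoint fun i => by
      by_cases hi : i ∈ u
      · exact .inl (hu i hi)
      · exact .inr (Set.indicator_of_notMem hi P)
  have hsN : s.indicator P ∈ C.normalizer := by
    refine mem_normalizer_of_span hspan fun Q hQ => ?_
    rcases hdec Q hQ with h | h
    · exact hzero Q s h
    · simpa [hzero Q t h] using hcomm Q hQ
  have htN : t.indicator P ∈ C.normalizer := by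
    refine mem_normalizer_of_span hspan fun Q hQ => ?_
    rcases hdec Q hQ with h | h
    · simpa [hzero Q s h] using hcomm Q hQ
    · exact hzero Q t h
  rw [hsum]
  exact C.gauge.add_mem (hs _ hsN fun i hi => Set.mem_of_indicator_ne_zero hi)
    (ht _ htN fun i hi => Set.mem_of_indicator_ne_zero hi)

end SubsystemCode

/-! ### Decomposition into expanders -/

theorem Set.ncard_preimage_le_mul {ι V : Type*} [Finite ι] [Finite V] {f : ι → V} {b : ℕ}
    (hb : ∀ v, {i | f i = v}.ncard ≤ b) (A : Set V) : (f ⁻¹' A).ncard ≤ b * A.ncard := by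
  induction A, A.toFinite using Set.Finite.induction_on with
  | empty => simp
  | @insert v A hv _ ih =>
    have h : f ⁻¹' insert v A = {i | f i = v} ∪ f ⁻¹' A := by
      ext i
      simp
    rw [Set.ncard_insert_of_notMem hv, h]
    have h₁ := Set.ncard_union_le {i | f i = v} (f ⁻¹' A)
    have h₂ := hb v
    lia

/-- A set that is not an expander splits along a sparse cut, and the cut can be removed by deleting
few vertices. -/
theorem SimpleGraph.exists_sparse_cut {V : Type*} [Finite V] (G : SimpleGraph V) {U : Set V} {α : ℝ}
    (hU : ¬ (G.induce U).IsExpander α) :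
    ∃ S T X : Set V, S.Nonempty ∧ T.Nonempty ∧ Disjoint S T ∧ S ∪ T = U ∧ X ⊆ S ∧
      (X.ncard : ℝ) ≤ α * (min S.ncard T.ncard : ℕ) ∧
      ∀ u ∈ S, u ∉ X → ∀ v ∈ T, ¬ G.Adj u v := by
  simp only [IsExpander, not_forall, not_le] at hU
  obtain ⟨S, hS, hT, hlt⟩ := hU
  refine ⟨Subtype.val '' S, Subtype.val '' Sᶜ,
    Subtype.val '' {u | u ∈ S ∧ ∃ v ∈ Sᶜ, G.Adj u v}, hS.image _, hT.image _,
    (Set.disjoint_image_iff Subtype.val_injective).2 disjoint_compl_right, ?_,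
    Set.image_mono fun u hu => hu.1, ?_, ?_⟩
  · rw [← Set.image_union]
    simp
  · have hpos : (0 : ℝ) < (min S.ncard Sᶜ.ncard : ℕ) := by
      have h₁ := (Set.ncard_pos (Set.toFinite _)).2 hS
      have h₂ := (Set.ncard_pos (Set.toFinite _)).2 hT
      exact_mod_cast lt_min h₁ h₂
    rw [Set.ncard_image_of_injective _ Subtype.val_injective,
      Set.ncard_image_of_injective _ Subtype.val_injective,
      Set.ncard_image_of_injective _ Subtype.val_injective]
    refine le_trans ?_ ((div_lt_iff₀ hpos).1 hlt).le
    -- Sending a boundary vertex to one of its cut edges is injective, since a cut edge has only one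
    -- endpoint in `S`.
    have hc : ∀ u : U, ∃ v : U, (u ∈ S ∧ ∃ v ∈ Sᶜ, G.Adj u v) → v ∈ Sᶜ ∧ G.Adj u v := by
      intro u
      by_cases h : u ∈ S ∧ ∃ v ∈ Sᶜ, G.Adj u v
      · obtain ⟨v, hv⟩ := h.2
        exact ⟨v, fun _ => hv⟩
      · exact ⟨u, fun h' => (h h').elim⟩
    choose g hg using hc
    have hcard := Set.ncard_le_ncard_of_injOn
      (s := {u : U | u ∈ S ∧ ∃ v ∈ Sᶜ, G.Adj u v}) (t := (G.induce U).cutEdges S)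
      (fun u => s(u, g u)) (fun u hu => ⟨u, hu.1, g u, (hg u hu).1, (hg u hu).2, rfl⟩) (by
        intro u hu w hw h
        rcases Sym2.eq_iff.1 h with h | h
        · exact h.1
        · exact ((hg w hw).1 (h.1 ▸ hu.1)).elim)
    exact_mod_cast hcard
  · rintro _ ⟨u, hu, rfl⟩ huX _ ⟨v, hv, rfl⟩ huv
    exact huX ⟨u, ⟨hu, v, hv, huv⟩, rfl⟩

/-- Superadditivity of `x log x`, with the gain from splitting. -/
theorem mul_log_add_mul_log_add_le {s t : ℝ} (hs : 0 < s) (ht : 0 < t) :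
    s * Real.log s + t * Real.log t + Real.log 2 * min s t ≤ (s + t) * Real.log (s + t) := by
  wlog hst : s ≤ t generalizing s t
  · have := this ht hs (le_of_not_ge hst)
    rw [min_comm, add_comm s t]
    linarith
  rw [min_eq_left hst]
  -- The smaller part at least doubles: `2s ≤ s + t`.
  have h₁ : Real.log s + Real.log 2 ≤ Real.log (s + t) := by
    rw [← Real.log_mul hs.ne' two_ne_zero]
    exact Real.log_le_log (by positivity) (by linarith)
  have h₂ : Real.log t ≤ Real.log (s + t) := Real.log_le_log ht (by linarith)
  have h₃ := mul_le_mul_of_nonneg_left h₁ hs.le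
  have h₄ := mul_le_mul_of_nonneg_left h₂ ht.le
  linarith

/-- Cutting repeatedly along sparse cuts, every set of vertices contains disjoint large expanders
such that, after deleting them and few other vertices, no bare logical operator is supported on what
remains. -/
theorem SubsystemCode.exists_expanders {V : Type*} [Finite V] {n b : ℕ} {C : SubsystemCode n}
    {G : SimpleGraph V} {place : Fin n → V} {checks : Set (Pauli n)}
    (hb : ∀ v, {i | place i = v}.ncard ≤ b)
    (hspan : Submodule.span (ZMod 2) checks = C.gauge)
    (hlocal : ∀ P ∈ checks, ∀ i j, P i ≠ 0 → P j ≠ 0 →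
      place i = place j ∨ G.Adj (place i) (place j))
    {α : ℝ} (hα : 0 ≤ α) (U : Set V) :
    ∃ (r : ℕ) (H : Fin r → Set V) (X : Set V),
      (∀ j, H j ⊆ U) ∧ Pairwise (Function.onFun Disjoint H) ∧
      (∀ j, C.distance ≤ b * (H j).ncard) ∧ (∀ j, (G.induce (H j)).IsExpander α) ∧
      (X.ncard : ℝ) ≤ ∑ j, ((H j).ncard : ℝ) +
        α / Real.log 2 * (U.ncard * Real.log U.ncard) ∧
      C.NoBareLogical (place ⁻¹' (U \ X)) := by
  induction hm : U.ncard using Nat.strong_induction_on generalizing U with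
  | _ m ih =>
  subst hm
  have hlog2 : 0 < Real.log 2 := Real.log_pos one_lt_two
  have hpot : 0 ≤ α / Real.log 2 * (U.ncard * Real.log U.ncard) :=
    mul_nonneg (div_nonneg hα hlog2.le)
      (mul_nonneg (Nat.cast_nonneg _) (Real.log_natCast_nonneg _))
  rcases lt_or_ge (b * U.ncard) C.distance with hsmall | hlarge
  · refine ⟨0, Fin.elim0, ∅, fun j => j.elim0, fun j => j.elim0, fun j => j.elim0,
      fun j => j.elim0, by simpa using hpot, ?_⟩
    rw [Set.sdiff_empty]
    exact noBareLogical_of_ncard_lt ((Set.ncard_preimage_le_mul hb U).trans_lt hsmall)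
  by_cases hexp : (G.induce U).IsExpander α
  · refine ⟨1, fun _ => U, U, fun _ => subset_rfl,
      fun i j hij => (hij (Subsingleton.elim i j)).elim, fun _ => hlarge, fun _ => hexp,
      by simpa using hpot, ?_⟩
    intro P _ hP
    have : P = 0 := by
      ext1 i
      by_contra hi
      have := hP i hi
      simp at this
    exact this ▸ C.gauge.zero_mem
  obtain ⟨S, T, Y, hS, hT, hST, rfl, hY, hYcard, hadj⟩ := G.exists_sparse_cut hexp
  have hScard := (Set.ncard_pos (Set.toFinite _)).2 hS
  have hTcard := (Set.ncard_pos (Set.toFinite _)).2 hT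
  have hUcard : (S ∪ T).ncard = S.ncard + T.ncard := Set.ncard_union_eq hST
  obtain ⟨r₁, H₁, X₁, hH₁, hdisj₁, hbig₁, hexp₁, hX₁, hclean₁⟩ := ih S.ncard (by lia) S rfl
  obtain ⟨r₂, H₂, X₂, hH₂, hdisj₂, hbig₂, hexp₂, hX₂, hclean₂⟩ := ih T.ncard (by lia) T rfl
  refine ⟨r₁ + r₂, Fin.append H₁ H₂, X₁ ∪ X₂ ∪ Y, ?_, ?_, ?_, ?_, ?_, ?_⟩
  · refine fun j => Fin.addCases (fun j => ?_) (fun j => ?_) j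
    · simpa using (hH₁ j).trans Set.subset_union_left
    · simpa using (hH₂ j).trans Set.subset_union_right
  · intro i j hij
    induction i using Fin.addCases with
    | left i =>
      induction j using Fin.addCases with
      | left j =>
        simpa [Function.onFun] using hdisj₁ fun h : i = j => hij (h ▸ rfl)
      | right j => simpa [Function.onFun] using hST.mono (hH₁ i) (hH₂ j)
    | right i =>
      induction j using Fin.addCases with
      | left j => simpa [Function.onFun] using (hST.mono (hH₁ j) (hH₂ i)).symm
      | right j =>
        simpa [Function.onFun] using hdisj₂ fun h : i = j => hij (h ▸ rfl)
  · refine fun j => Fin.addCases (fun j => ?_) (fun j => ?_) j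
    · simpa using hbig₁ j
    · simpa using hbig₂ j
  · refine fun j => Fin.addCases (fun j => ?_) (fun j => ?_) j
    · rw [Fin.append_left]
      exact hexp₁ j
    · rw [Fin.append_right]
      exact hexp₂ j
  · have h₁ : ((X₁ ∪ X₂ ∪ Y).ncard : ℝ) ≤ X₁.ncard + X₂.ncard + Y.ncard := by
      have h₁ := Set.ncard_union_le (X₁ ∪ X₂) Y
      have h₂ := Set.ncard_union_le X₁ X₂
      exact_mod_cast (by lia : (X₁ ∪ X₂ ∪ Y).ncard ≤ X₁.ncard + X₂.ncard + Y.ncard)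
    have h₂ := mul_log_add_mul_log_add_le (s := S.ncard) (t := T.ncard)
      (by exact_mod_cast hScard) (by exact_mod_cast hTcard)
    -- The gain in `x log x`, scaled by `α / log 2`, is exactly the bound on the size of `Y`.
    have h₃ := mul_le_mul_of_nonneg_left h₂ (div_nonneg hα hlog2.le)
    have h₄ : α / Real.log 2 * (Real.log 2 * min (S.ncard : ℝ) T.ncard) =
        α * min (S.ncard : ℝ) T.ncard := by
      field_simp
    rw [hUcard]
    simp only [Fin.sum_univ_add, Fin.append_left, Fin.append_right]
    push_cast at hYcard ⊢
    linarith
  · have hunion : C.NoBareLogical (place ⁻¹' (S \ (X₁ ∪ Y)) ∪ place ⁻¹' (T \ X₂)) := by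
      refine NoBareLogical.union hspan ?_ ?_ ?_ ?_
      · exact (hST.mono Set.sdiff_subset Set.sdiff_subset).preimage _
      · intro Q hQ
        by_contra! h
        obtain ⟨⟨i, hi, hQi⟩, ⟨j, hj, hQj⟩⟩ := h
        rcases hlocal Q hQ i j hQi hQj with h | h
        · exact Set.disjoint_left.1 hST hi.1 (h ▸ hj.1)
        · exact hadj _ hi.1 (fun hY => hi.2 (.inr hY)) _ hj.1 h
      · exact fun P hP h => hclean₁ P hP fun i hi => ⟨(h i hi).1, fun hX => (h i hi).2 (.inl hX)⟩
      · exact hclean₂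
    intro P hP h
    refine hunion P hP fun i hi => ?_
    obtain ⟨hU, hX⟩ := h i hi
    rcases hU with hU | hU
    · exact .inl ⟨hU, fun h => hX (h.elim (fun h => .inl (.inl h)) .inr)⟩
    · exact .inr ⟨hU, fun h => hX (.inl (.inr h))⟩

/-! ### Consequences for the code parameters. -/

theorem SubsystemCode.HasConnectivity.qubits_per_vertex_pos {V : Type*} {G : SimpleGraph V}
    {b n : ℕ} {C : SubsystemCode n} (hG : C.HasConnectivity G b) (hn : 0 < n) : 0 < b := by
  obtain ⟨place, -, hb, -⟩ := hG
  refine lt_of_lt_of_le ?_ (hb (place ⟨0, hn⟩))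
  exact (Set.ncard_pos (Set.toFinite _)).2 ⟨⟨0, hn⟩, rfl⟩

/-- A code with a given connectivity graph needs large disjoint expanders in the graph. -/
theorem SubsystemCode.HasConnectivity.exists_expanders {V : Type*} [Finite V] {G : SimpleGraph V}
    {b n k d : ℕ} {C : SubsystemCode n} (hn : 2 ≤ n) (hC : C.HasParameters k d)
    (hG : C.HasConnectivity G b) :
    ∃ (r : ℕ) (H : Fin r → Set V),
      Pairwise (Function.onFun Disjoint H) ∧
      (∀ j, (d : ℝ) / (3 * b) ≤ (H j).ncard) ∧
      (k : ℝ) / (2 * b) ≤ ∑ j, ((H j).ncard : ℝ) ∧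
      ∀ j, (G.induce (H j)).IsExpander ((k : ℝ) / (4 * 1 * b * Real.log n * n)) := by
  have hbpos : 0 < b := hG.qubits_per_vertex_pos (by lia)
  obtain ⟨place, checks, hb, hspan, hlocal⟩ := hG
  have hn0 : (0 : ℝ) < n := by exact_mod_cast (by lia : 0 < n)
  have hlog : 0 < Real.log n := Real.log_pos (by exact_mod_cast (by lia : 1 < n))
  have hb0 : (0 : ℝ) < b := by exact_mod_cast hbpos
  set α : ℝ := (k : ℝ) / (4 * 1 * b * Real.log n * n) with hαdef
  have hα : 0 ≤ α := by positivity
  -- Starting from the occupied vertices keeps the potential below `n log n`, however large `V` is.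
  obtain ⟨r, H, X, -, hdisj, hbig, hexp, hX, hclean⟩ :=
    C.exists_expanders hb hspan hlocal hα (Set.range place)
  refine ⟨r, H, hdisj, fun j => ?_, ?_, hexp⟩
  · rw [div_le_iff₀ (by positivity)]
    have h : (d : ℝ) ≤ b * (H j).ncard := by
      rw [← hC.2]
      exact_mod_cast hbig j
    have : (0 : ℝ) ≤ b * (H j).ncard := by positivity
    linarith
  · have hk : k ≤ (place ⁻¹' X).ncard :=
      le_ncard_of_noBareLogical_compl hC fun P hP h =>
        hclean P hP fun i hi => ⟨Set.mem_range_self i, h i hi⟩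
    have hkX : (k : ℝ) ≤ b * X.ncard := by
      exact_mod_cast hk.trans (Set.ncard_preimage_le_mul hb X)
    have hU : (Set.range place).ncard ≤ n := by
      rw [← Set.image_univ]
      simpa using Set.ncard_image_le (f := place) (s := Set.univ)
    have hUpos : 0 < (Set.range place).ncard :=
      (Set.ncard_pos (Set.toFinite _)).2 ⟨_, Set.mem_range_self ⟨0, by lia⟩⟩
    have hUn : (Set.range place).ncard * Real.log (Set.range place).ncard ≤ n * Real.log n :=
      mul_le_mul (by exact_mod_cast hU)
        (Real.log_le_log (by exact_mod_cast hUpos) (by exact_mod_cast hU))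
        (Real.log_natCast_nonneg _) hn0.le
    -- The cuts cost `k / (4 log 2)` qubits, so `c = 1` suffices because `log 2 > 1/2`.
    have hlog2 : (1 / 2 : ℝ) < Real.log 2 := by linarith [Real.log_two_gt_d9]
    have hpot : b * (α / Real.log 2 * (n * Real.log n)) ≤ k / 2 := by
      have h : b * (α / Real.log 2 * (n * Real.log n)) = k / (4 * Real.log 2) := by
        rw [hαdef]
        field_simp
      rw [h]
      exact div_le_div_of_nonneg_left (Nat.cast_nonneg _) two_pos (by linarith)
    have h₁ := mul_le_mul_of_nonneg_left hX hb0.le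
    have h₂ := mul_le_mul_of_nonneg_left hUn (by positivity : 0 ≤ b * (α / Real.log 2))
    rw [div_le_iff₀ (by positivity)]
    linarith

theorem mainTheorem9 :
    ∃ c : ℝ, 0 < c ∧
      ∀ {V : Type*} [Finite V] (G : SimpleGraph V) (b n k d : ℕ) (C : SubsystemCode n),
        2 ≤ n → C.HasParameters k d → C.HasConnectivity G b →
        -- disjoint large expanding subgraphs
        (∃ (r : ℕ) (H : Fin r → Set V),
          Pairwise (Function.onFun Disjoint H) ∧
          (∀ j, (d : ℝ) / (3 * b) ≤ (H j).ncard) ∧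
          (k : ℝ) / (2 * b) ≤ ∑ j, ((H j).ncard : ℝ) ∧
          ∀ j, (G.induce (H j)).IsExpander ((k : ℝ) / (4 * c * b * Real.log n * n))) ∧
        -- bound on the parameters of codes with linear distance
        d ≤ n ∧
        ∀ δ α : ℝ, 0 < δ → 0 ≤ α → δ * n ≤ d →
          (∀ U : Set V, δ * n / (3 * b) ≤ (U.ncard : ℝ) →
            ∀ β : ℝ, (G.induce U).IsExpander β → β ≤ α) →
          (k : ℝ) ≤ 4 * c * b * α * n * Real.log n := by
  refine ⟨1, one_pos, fun {V} _ G b n k d C hn hC hG => ?_⟩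
  have hmain := hG.exists_expanders hn hC
  refine ⟨hmain, hC.2 ▸ C.distance_le, fun δ α _ hα hδd hU => ?_⟩
  obtain ⟨r, H, -, hbig, hsum, hexp⟩ := hmain
  have hlog : 0 < Real.log n := Real.log_pos (by exact_mod_cast (by lia : 1 < n))
  have hb0 : 0 < b := hG.qubits_per_vertex_pos (by lia)
  rcases Nat.eq_zero_or_pos k with rfl | hk
  · simp only [Nat.cast_zero]
    positivity
  -- As `k > 0`, the sizes have a positive sum, so some expander exists; its expansion is at most
  -- `α`.
  have hr : r ≠ 0 := by
    rintro rfl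
    rw [Fin.sum_univ_zero] at hsum
    exact absurd hsum (not_le.2 (by positivity))
  let j : Fin r := ⟨0, Nat.pos_of_ne_zero hr⟩
  have h := hU (H j) ((div_le_div_of_nonneg_right hδd (by positivity)).trans (hbig j)) _ (hexp j)
  rw [div_le_iff₀ (by positivity)] at h
  linarith
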